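/- **Conventions.** Let $\mathcal K$ be a category of posets, i.e. a (not necessarily full) subcategory of the category of posets and monotone maps. Each $\mathcal C$ in $\mathcal K$ is equipped with a subcanonical Grothendieck topology $J_{\mathcal C}$, in such a way that every arrow $f:\mathcal C\to\mathcal D$ of $\mathcal K$ is a morphism of sites $(\mathcal C,J_{\mathcal C})\to(\mathcal D,J_{\mathcal D})$ (a flat, cover-preserving functor). A *$J$-ideal* on $\mathcal C$ is a lower set $I$ that contains every $c$ having a $J$-covering sieve all of whose domains lie in $I$; $Id_J(\mathcal C)$ is the locale whose frame is the set of $J$-ideals ordered by inclusion; the principal $J$-ideal of $c$ is the smallest one containing $c$, and $c\mapsto$ (its principal ideal) is the canonical embedding $\mathcal C\hookrightarrow Id_J(\mathcal C)$. Let $A:\mathcal K^{op}\to\mathbf{Loc}$ be the functor $\mathcal C\mapsto Id_{J_{\mathcal C}}(\mathcal C)$, where $A(f)$ corresponds to the frame homomorphism sending a $J_{\mathcal C}$-ideal $I$ to the smallest $J_{\mathcal D}$-ideal containing $f(I)$. A functor $F$ *creates isomorphisms* if every isomorphism $F(c)\cong F(d)$ is $F(u)$ for an isomorphism $u:c\cong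 d$. For such an $F$, $ExtIm(F)$ is the subcategory of the codomain whose objects are those isomorphic to some $F(c)$ and whose arrows are those identified, through isomorphisms of their domain and codomain with objects $F(c),F(c')$, with an arrow $F(u)$, $u:c\to c'$. An *invariant* $C$ is a property of families (sets) of elements of locales (equivalently, of families of subterminals of locally small cocomplete toposes) that is stable under isomorphism. A family $t$ *refines* $s$ if each element of $t$ is below some element of $s$ and $\bigvee t=\bigvee s$. An element $l$ of a locale is *$C$-compact* if every family with join $l$ has a refinement satisfying $C$. A *basis* of a locale is a subset such that every element is a join of elements of it. Let $P$ denote isomorphism-invariant properties of embeddings $B\hookrightarrow L$ of a basis (with the induced order) into a frame that hold for all the canonical embeddings $\mathcal C\hookrightarrow Id_{J_{\mathcal C}}(\mathcal C)$, $\mathcal C$ in $\mathcal K$. * $J_{\mathcal C}$ is *$C$-induced* if for some such $P$ the following holds: for every order embedding $i:\mathcal C\hookrightarrow L$ into a frame whose image is a basis, which satisfies $P$ and sends $J_{\mathcal C}$-covering sieves to covering families (i.e. $\bigvee_{f\in S} i(\mathrm{dom} f)=i(c)$ for a covering sieve $S$ on $c$), and for every family $\mathcal A$ of elements of $\mathcal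 C$: there is an upper bound $c$ of $\mathcal A$ such that the arrows $a\le c$, $a\in\mathcal A$, generate a $J_{\mathcal C}$-covering sieve if and only if $i(\mathcal A)$ has a refinement satisfying $C$ made of elements of $i(\mathcal C)$. * A *$\mathcal K$-basis relative to $P$* of a locale $L$ is an order embedding $i:\mathcal C\hookrightarrow L$ with $\mathcal C$ in $\mathcal K$ such that: its image is a basis of $L$ made of $C$-compact elements; it satisfies $P$; every family with join $i(c)$, $c\in\mathcal C$, has a refinement satisfying $C$ made of elements of $i(\mathcal C)$; and $i$ sends $J_{\mathcal C}$-covering sieves to covering families. * $C$ is *$\mathcal K$-compatible relative to $P$* if for every $\mathcal K$-basis $i:\mathcal C\hookrightarrow L$ relative to $P$, $J_{\mathcal C}$ is the topology induced by the canonical topology of $L$: a sieve $S$ on $c$ is $J_{\mathcal C}$-covering if and only if $\bigvee_{f\in S} i(\mathrm{dom} f)=i(c)$. **Theorem.** 1. The functor $A$ is injective on objects and yields an isomorphism of categories between $\mathcal K^{op}$ and the image of $A$. Now suppose that every order isomorphism between objects of $\mathcal K$ which is, together with its inverse, a morphism of sites is an arrow of $\mathcal K$. Let $C$ be an invariant such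 that, for every $\mathcal C$ in $\mathcal K$, each family of principal $J_{\mathcal C}$-ideals having a refinement satisfying $C$ has one made of principal $J_{\mathcal C}$-ideals, and suppose that all the topologies $J_{\mathcal C}$ are $C$-induced. Then: 2. $A$ creates isomorphisms, and the functor $A:\mathcal K^{op}\to ExtIm(A)$ has a categorical inverse (up to natural isomorphism) $I_A:ExtIm(A)\to\mathcal K^{op}$, which sends a locale $L$ to (a structure of $\mathcal K$ identified by an order isomorphism with) the poset of $C$-compact elements of $L$, and an arrow $f:L\to L'$ to the restriction, under these identifications, of the frame homomorphism of $f$ to the $C$-compact elements of $L'$ and $L$. 3. There is a property $P$ relative to which $C$ is $\mathcal K$-compatible. For every such $P$: (i) a locale belongs to $ExtIm(A)$ if and only if it has a $\mathcal K$-basis relative to $P$; (ii) for any locales $L,L'$ and any $\mathcal K$-bases $i:\mathcal C\hookrightarrow L$, $i':\mathcal C'\hookrightarrow L'$ relative to $P$, the images of $i$ and $i'$ are the sets of $C$-compact elements of $L$ and $L'$, and a locale morphism $L\to L'$ is an arrow of $ExtIm(A)$ if and only if its frame homomorphism sends $C$-compact elements of $L'$ to $C$-compact elements of $L$ and its restriction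 to them is identified, through $i'$ and $i$, with an arrow $\mathcal C'\to\mathcal C$ of $\mathcal K$. -/

import Mathlib

open CategoryTheory Opposite

universe u

namespace PosetDuality

section Ideals

variable {C : Type u} [PartialOrder C]

/-- `I` is a `J`-ideal: a lower set such that an object covered by a `J`-covering sieve
all of whose domains lie in `I` lies itself in `I`. -/
def IsJIdeal (J : GrothendieckTopology C) (I : Set C) : Prop :=
  (∀ ⦃a b : C⦄, b ≤ a → a ∈ I → b ∈ I) ∧
    ∀ (c : C) (R : Sieve c), R ∈ J c → (∀ (d : C) (f : d ⟶ c), R f → d ∈ I) → c ∈ I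

/-- `Id_J(C)`: the set of `J`-ideals on `C`, a set of subsets of `C`
(ordered by inclusion, as a subtype of `Set C`). -/
def jIdeals (J : GrothendieckTopology C) : Set (Set C) := {I | IsJIdeal J I}

variable (J : GrothendieckTopology C)

theorem isJIdeal_sInter {s : Set (Set C)} (hs : ∀ I ∈ s, IsJIdeal J I) : IsJIdeal J (⋂₀ s) :=
  ⟨fun _ _ hba ha I hI => (hs I hI).1 hba (ha I hI),
    fun c R hR h I hI => (hs I hI).2 c R hR fun d f hf => h d f hf I hI⟩

instance : InfSet (jIdeals J) :=
  ⟨fun s => ⟨⋂₀ (Subtype.val '' s), isJIdeal_sInter J (by rintro _ ⟨I, _, rfl⟩; exact I.2)⟩⟩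

theorem isGLB_sInf_jIdeals (s : Set (jIdeals J)) : IsGLB s (sInf s) :=
  ⟨fun I hI _ hx => hx _ ⟨I, hI, rfl⟩,
    fun _ hK _ hx => by rintro _ ⟨I, hI, rfl⟩; exact hK hI hx⟩

instance : CompleteLattice (jIdeals J) := completeLatticeOfInf _ (isGLB_sInf_jIdeals J)

theorem mem_inf_iff (I K : jIdeals J) (x : C) : x ∈ (I ⊓ K).1 ↔ x ∈ I.1 ∧ x ∈ K.1 := by
  constructor
  · intro h
    exact ⟨(inf_le_left : I ⊓ K ≤ I) h, (inf_le_right : I ⊓ K ≤ K) h⟩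
  · intro h
    have hIK : IsJIdeal J (I.1 ∩ K.1) :=
      ⟨fun a b hba ha => ⟨I.2.1 hba ha.1, K.2.1 hba ha.2⟩, fun c R hR hd =>
        ⟨I.2.2 c R hR fun d f hf => (hd d f hf).1, K.2.2 c R hR fun d f hf => (hd d f hf).2⟩⟩
    exact (le_inf (fun _ hx => hx.1) (fun _ hx => hx.2) : (⟨_, hIK⟩ : jIdeals J) ≤ I ⊓ K) h

/-- For a lower set `A` and a `J`-ideal `B`, the set of all `c` with `↓c ∩ A ⊆ B` is a `J`-ideal. -/
theorem isJIdeal_imp {A B : Set C} (hA : ∀ ⦃a b : C⦄, b ≤ a → a ∈ A → b ∈ A)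
    (hB : IsJIdeal J B) : IsJIdeal J {c | ∀ d, d ≤ c → d ∈ A → d ∈ B} := by
  refine ⟨fun a b hba ha d hd => ha d (hd.trans hba), fun c R hR h d hdc hdA => ?_⟩
  refine hB.2 d (R.pullback (homOfLE hdc)) (J.pullback_stable _ hR) fun e f hf => ?_
  exact h e _ hf e le_rfl (hA (leOfHom f) hdA)

instance : Order.Frame (jIdeals J) :=
  Order.Frame.ofMinimalAxioms
    { inf_sSup_le_iSup_inf := by
        intro a s
        have key : sSup s ≤ (⟨_, isJIdeal_imp J a.2.1 (⨆ b ∈ s, a ⊓ b).2⟩ : jIdeals J) := by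
          refine sSup_le fun b hb x hx d hdx hda => ?_
          exact (le_iSup₂ (f := fun b (_ : b ∈ s) => a ⊓ b) b hb)
            ((mem_inf_iff J a b d).2 ⟨hda, b.2.1 hdx hx⟩)
        intro x hx
        rw [mem_inf_iff] at hx
        exact key hx.2 x le_rfl hx.1 }

/-- The smallest `J`-ideal containing a set. -/
def genIdeal (A : Set C) : jIdeals J := sInf {I | A ⊆ I.1}

theorem genIdeal_le_iff (A : Set C) (I : jIdeals J) : genIdeal J A ≤ I ↔ A ⊆ I.1 := by
  constructor
  · intro h x hx
    refine h ?_
    rintro _ ⟨K, hK, rfl⟩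
    exact hK hx
  · intro h
    exact (isGLB_sInf_jIdeals J _).1 h

theorem subset_genIdeal (A : Set C) : A ⊆ (genIdeal J A).1 := (genIdeal_le_iff J A _).1 le_rfl

/-- The principal `J`-ideal generated by `c`. -/
def principalIdeal (c : C) : jIdeals J := genIdeal J {c}

/-- The family of all principal `J`-ideals, i.e. the image of `C → Id_J(C)`. -/
def principalIdeals : Set (jIdeals J) := Set.range (principalIdeal J)

end Ideals

section Sites

variable {C D E : Type u} [PartialOrder C] [PartialOrder D] [PartialOrder E]

/-- A monotone map of posets is a morphism of sites if it is flat and cover-preserving as a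
functor. -/
structure IsSiteMorphism (J : GrothendieckTopology C) (K : GrothendieckTopology D)
    (f : C →o D) : Prop where
  flat : RepresentablyFlat f.monotone.functor
  cover : CoverPreserving J K f.monotone.functor

variable {J : GrothendieckTopology C} {K : GrothendieckTopology D} {L : GrothendieckTopology E}

theorem IsSiteMorphism.exists_le {f : C →o D} (hf : IsSiteMorphism J K f) (d : D) :
    ∃ c, d ≤ f c := by
  have := hf.flat.cofiltered d
  obtain ⟨x⟩ := this.nonempty
  exact ⟨x.right, leOfHom x.hom⟩

theorem IsSiteMorphism.exists_le_le {f : C →o D} (hf : IsSiteMorphism J K f) {d : D} {c c' : C}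
    (h : d ≤ f c) (h' : d ≤ f c') : ∃ e, e ≤ c ∧ e ≤ c' ∧ d ≤ f e := by
  have := hf.flat.cofiltered d
  obtain ⟨x, g, g', _⟩ := IsCofilteredOrEmpty.cone_objs
    (StructuredArrow.mk (T := f.monotone.functor) (Y := c) (homOfLE h))
    (StructuredArrow.mk (T := f.monotone.functor) (Y := c') (homOfLE h'))
  exact ⟨x.right, leOfHom g.right, leOfHom g'.right, leOfHom x.hom⟩

/-- The inverse image of a `K`-ideal under a morphism of sites is a `J`-ideal. -/
theorem IsSiteMorphism.isJIdeal_preimage {f : C →o D} (hf : IsSiteMorphism J K f) {I : Set D}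
    (hI : IsJIdeal K I) : IsJIdeal J (f ⁻¹' I) := by
  refine ⟨fun a b hba ha => hI.1 (f.monotone hba) ha, fun c R hR h => ?_⟩
  refine hI.2 _ _ (hf.cover.cover_preserve hR) ?_
  rintro d g ⟨e, k, l, hk, -⟩
  exact hI.1 (leOfHom l) (h e k hk)

/-- The action of a morphism of sites on ideals: `I` goes to the smallest ideal containing
the image of `I`. -/
def idealMap (J : GrothendieckTopology C) (K : GrothendieckTopology D) (f : C →o D)
    (I : jIdeals J) : jIdeals K :=
  genIdeal K (f '' I.1)

theorem IsSiteMorphism.idealMap_le_iff {f : C →o D} (hf : IsSiteMorphism J K f) (I : jIdeals J)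
    (X : jIdeals K) : idealMap J K f I ≤ X ↔ I ≤ ⟨f ⁻¹' X.1, hf.isJIdeal_preimage X.2⟩ := by
  rw [idealMap, genIdeal_le_iff, Set.image_subset_iff]
  rfl

theorem idealMap_mono (f : C →o D) {I I' : jIdeals J} (h : I ≤ I') :
    idealMap J K f I ≤ idealMap J K f I' :=
  (genIdeal_le_iff _ _ _).2 ((Set.image_mono h).trans (subset_genIdeal _ _))

theorem mem_idealMap (f : C →o D) {I : jIdeals J} {c : C} (hc : c ∈ I.1) :
    f c ∈ (idealMap J K f I).1 :=
  subset_genIdeal _ _ ⟨c, hc, rfl⟩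

theorem IsSiteMorphism.idealMap_inf {f : C →o D} (hf : IsSiteMorphism J K f) (I I' : jIdeals J) :
    idealMap J K f (I ⊓ I') = idealMap J K f I ⊓ idealMap J K f I' := by
  apply le_antisymm
  · exact le_inf (idealMap_mono f inf_le_left) (idealMap_mono f inf_le_right)
  · set X := idealMap J K f (I ⊓ I') with hX
    have h1 : ∀ c ∈ I.1, idealMap J K f I' ≤
        ⟨_, isJIdeal_imp K (A := Set.Iic (f c)) (fun _ _ h h' => le_trans h h') X.2⟩ := by
      intro c hc
      refine (genIdeal_le_iff _ _ _).2 ?_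
      rintro _ ⟨c', hc', rfl⟩ d hd hd'
      obtain ⟨e, hec, hec', hde⟩ := hf.exists_le_le hd' hd
      exact X.2.1 hde (mem_idealMap f ((mem_inf_iff J I I' e).2
        ⟨I.2.1 hec hc, I'.2.1 hec' hc'⟩))
    have h2 : idealMap J K f I ≤
        ⟨_, isJIdeal_imp K (A := (idealMap J K f I').1) (idealMap J K f I').2.1 X.2⟩ := by
      refine (genIdeal_le_iff _ _ _).2 ?_
      rintro _ ⟨c, hc, rfl⟩ d hd hd'
      exact h1 c hc hd' d le_rfl hd
    intro x hx
    rw [mem_inf_iff] at hx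
    exact h2 hx.1 x le_rfl hx.2

theorem IsSiteMorphism.idealMap_top {f : C →o D} (hf : IsSiteMorphism J K f) :
    idealMap J K f ⊤ = ⊤ := by
  refine top_le_iff.1 fun d _ => ?_
  obtain ⟨c, hc⟩ := hf.exists_le d
  have hu : IsJIdeal J (Set.univ : Set C) :=
    ⟨fun _ _ _ _ => trivial, fun _ _ _ _ => trivial⟩
  have : c ∈ (⊤ : jIdeals J).1 := (le_top : (⟨_, hu⟩ : jIdeals J) ≤ ⊤) trivial
  exact (idealMap J K f ⊤).2.1 hc (mem_idealMap f this)

theorem IsSiteMorphism.idealMap_sSup {f : C →o D} (hf : IsSiteMorphism J K f)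
    (s : Set (jIdeals J)) : idealMap J K f (sSup s) = sSup (idealMap J K f '' s) := by
  apply le_antisymm
  · rw [hf.idealMap_le_iff]
    refine sSup_le fun I hI => ?_
    rw [← hf.idealMap_le_iff]
    exact le_sSup ⟨I, hI, rfl⟩
  · refine sSup_le ?_
    rintro _ ⟨I, hI, rfl⟩
    exact idealMap_mono f (le_sSup hI)

/-- The frame homomorphism `Id_J(C) → Id_K(D)` induced by a morphism of sites. -/
def idealFrameHom (f : C →o D) (hf : IsSiteMorphism J K f) : FrameHom (jIdeals J) (jIdeals K) where
  toFun := idealMap J K f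
  map_inf' := hf.idealMap_inf
  map_top' := hf.idealMap_top
  map_sSup' := hf.idealMap_sSup

theorem genIdeal_coe (I : jIdeals J) : genIdeal J I.1 = I :=
  le_antisymm ((genIdeal_le_iff _ _ _).2 subset_rfl) (subset_genIdeal _ _)

theorem idealMap_id (I : jIdeals J) : idealMap J J OrderHom.id I = I := by
  have : (OrderHom.id : C →o C) '' I.1 = I.1 := by ext; simp
  rw [idealMap, this, genIdeal_coe]

theorem IsSiteMorphism.idealMap_comp {f : C →o D} {g : D →o E} (hg : IsSiteMorphism K L g)
    (I : jIdeals J) : idealMap J L (g.comp f) I = idealMap K L g (idealMap J K f I) := by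
  apply le_antisymm
  · refine (genIdeal_le_iff _ _ _).2 ?_
    rintro _ ⟨c, hc, rfl⟩
    exact mem_idealMap g (mem_idealMap f hc)
  · rw [hg.idealMap_le_iff, idealMap, genIdeal_le_iff]
    rintro _ ⟨c, hc, rfl⟩
    exact mem_idealMap (g.comp f) hc

end Sites

/-! ### Locales whose frame is literally a set of subsets -/

/-- A locale given by a set of subsets of a set that is a frame for the inclusion order. These
objects remember the sets they are made of, so that equality between them means what it does
in set theory. -/
structure SetLocale : Type (u + 1) where
  carrier : Type u
  opens : Set (Set carrier)
  [frame : Order.Frame opens]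
  le_iff : ∀ a b : opens, frame.le a b ↔ a.1 ⊆ b.1

attribute [instance] SetLocale.frame

/-- The arrows `X ⟶ Y` are the locale morphisms, i.e. the frame homomorphisms from `Y` to `X`. -/
instance : Category SetLocale.{u} where
  Hom X Y := FrameHom Y.opens X.opens
  id X := FrameHom.id X.opens
  comp f g := FrameHom.comp f g

/-- The fully faithful functor from set-theoretic locales to locales. -/
def SetLocale.toLocale : SetLocale.{u} ⥤ Locale.{u} where
  obj X := Locale.of X.opens
  map f := (Frm.ofHom f).op

/-- The frame homomorphism associated with a locale morphism. -/
def inverseImage {X Y : Locale.{u}} (f : X ⟶ Y) : FrameHom Y X :=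
  Frm.Hom.hom (Quiver.Hom.unop f)

/-! ### Categories of posets equipped with topologies -/

/-- A category `K` of posets (a not necessarily full subcategory of the category of posets and
monotone maps), each of them equipped with a subcanonical Grothendieck topology in such a way that
every arrow of `K` is a morphism of sites. -/
structure PosetCat : Type (u + 1) where
  Mem : PartOrd.{u} → Prop
  Arr : ∀ {X Y : PartOrd.{u}}, (X ⟶ Y) → Prop
  id_arr : ∀ X, Mem X → Arr (𝟙 X)
  comp_arr : ∀ {X Y Z : PartOrd.{u}} (f : X ⟶ Y) (g : Y ⟶ Z),
    Mem X → Mem Y → Mem Z → Arr f → Arr g → Arr (f ≫ g)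
  top : ∀ X : PartOrd.{u}, Mem X → GrothendieckTopology X
  subcanonical : ∀ (X : PartOrd.{u}) (hX : Mem X), (top X hX).Subcanonical
  isSiteMorphism : ∀ {X Y : PartOrd.{u}} (hX : Mem X) (hY : Mem Y) (f : X ⟶ Y), Arr f →
    IsSiteMorphism (top X hX) (top Y hY) f.hom

namespace PosetCat

/-- The objects of `K`. -/
structure Obj (K : PosetCat.{u}) : Type (u + 1) where
  poset : PartOrd.{u}
  mem : K.Mem poset

variable {K : PosetCat.{u}}

instance : CoeSort K.Obj (Type u) := ⟨fun c => c.poset⟩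

/-- The topology `J_c` of an object `c` of `K`. -/
def Obj.J (c : K.Obj) : GrothendieckTopology c := K.top c.poset c.mem

instance : Category K.Obj where
  Hom c d := {f : c.poset ⟶ d.poset // K.Arr f}
  id c := ⟨𝟙 c.poset, K.id_arr _ c.mem⟩
  comp {c d e} f g := ⟨f.1 ≫ g.1, K.comp_arr _ _ c.mem d.mem e.mem f.2 g.2⟩

/-- The monotone map underlying an arrow of `K`. -/
def orderHom {c d : K.Obj} (f : c ⟶ d) : c →o d := f.1.hom

theorem isSiteMorphism_orderHom {c d : K.Obj} (f : c ⟶ d) : IsSiteMorphism c.J d.J (orderHom f) :=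
  K.isSiteMorphism c.mem d.mem f.1 f.2

/-- The locale `Id_J(c)` of `J_c`-ideals on `c`. -/
def idealLocale (c : K.Obj) : SetLocale.{u} where
  carrier := c
  opens := jIdeals c.J
  le_iff _ _ := Iff.rfl

variable (K)

/-- The functor `K^op → Loc` sending `c` to `Id_J(c)`, with values in set-theoretic locales. -/
def setA : K.Objᵒᵖ ⥤ SetLocale.{u} where
  obj c := idealLocale c.unop
  map {X Y} f := idealFrameHom (J := Y.unop.J) (K := X.unop.J)
    (orderHom f.unop) (isSiteMorphism_orderHom f.unop)
  map_id c := FrameHom.ext fun I : jIdeals c.unop.J => idealMap_id I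
  map_comp {_ _ Z} f g := FrameHom.ext fun I : jIdeals Z.unop.J =>
    (isSiteMorphism_orderHom f.unop).idealMap_comp (f := orderHom g.unop) I

/-- The functor `A : K^op → Loc`. -/
def A : K.Objᵒᵖ ⥤ Locale.{u} := K.setA ⋙ SetLocale.toLocale

/-- `K` contains all isomorphisms between its structures: every order isomorphism between two
objects of `K` that is an isomorphism of sites is an arrow of `K`. -/
def ContainsIsos : Prop :=
  ∀ (c d : K.Obj) (e : c ≃o d),
    IsSiteMorphism c.J d.J (e : c →o d) → IsSiteMorphism d.J c.J (e.symm : d →o c) →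
      K.Arr (X := c.poset) (Y := d.poset) (PartOrd.ofHom (e : c →o d))

end PosetCat

/-! ### Image and extended image of a functor -/

section Images

universe v₁ v₂ u₁ u₂

variable {𝒞 : Type u₁} [Category.{v₁} 𝒞] {𝒟 : Type u₂} [Category.{v₂} 𝒟]

/-- The image of a functor that is injective on objects: the objects `F c` and the arrows `F f`. -/
structure Im (F : 𝒞 ⥤ 𝒟) (hF : Function.Injective F.obj) where
  obj : 𝒟
  mem : ∃ c, F.obj c = obj

namespace Im

variable {F : 𝒞 ⥤ 𝒟} {hF : Function.Injective F.obj}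

/-- `g` is of the form `F f`. -/
def IsArrow (F : 𝒞 ⥤ 𝒟) {x y : 𝒟} (g : x ⟶ y) : Prop :=
  ∃ (c d : 𝒞) (f : c ⟶ d) (hc : x = F.obj c) (hd : F.obj d = y),
    g = eqToHom hc ≫ F.map f ≫ eqToHom hd

instance : Category (Im F hF) where
  Hom x y := {g : x.obj ⟶ y.obj // IsArrow F g}
  id x := ⟨𝟙 x.obj, by
    obtain ⟨c, hc⟩ := x.mem
    exact ⟨c, c, 𝟙 c, hc.symm, hc, by simp⟩⟩
  comp {x y z} g h := ⟨g.1 ≫ h.1, by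
    obtain ⟨x, hx⟩ := x
    obtain ⟨y, hy⟩ := y
    obtain ⟨z, hz⟩ := z
    obtain ⟨g, c, d, f, hc, hd, hg⟩ := g
    obtain ⟨h, c', d', f', hc', hd', hh⟩ := h
    dsimp only at x y z g h hc hd hc' hd'
    subst hc hd hd'
    obtain rfl := hF hc'
    exact ⟨c, d', f ≫ f', rfl, rfl, by simp [hg, hh]⟩⟩

/-- The functor `F` with codomain restricted to its image. -/
def corestrict (F : 𝒞 ⥤ 𝒟) (hF : Function.Injective F.obj) : 𝒞 ⥤ Im F hF where
  obj c := ⟨F.obj c, c, rfl⟩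
  map {c d} f := ⟨F.map f, c, d, f, rfl, rfl, by simp⟩
  map_id c := Subtype.ext (F.map_id c)
  map_comp f g := Subtype.ext (F.map_comp f g)

end Im

/-- The functor `F` creates isomorphisms: every isomorphism `F c ≅ F d` is the image of an
isomorphism `c ≅ d`. -/
def CreatesIsos (F : 𝒞 ⥤ 𝒟) : Prop :=
  ∀ ⦃c d : 𝒞⦄ (l : F.obj c ≅ F.obj d), ∃ e : c ≅ d, F.mapIso e = l

/-- The extended image of a functor that creates isomorphisms; its objects are the objects
isomorphic to some `F c`. -/
structure ExtIm (F : 𝒞 ⥤ 𝒟) (hF : CreatesIsos F) where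
  obj : 𝒟
  mem : ∃ c, Nonempty (obj ≅ F.obj c)

namespace ExtIm

variable {F : 𝒞 ⥤ 𝒟} {hF : CreatesIsos F}

/-- The arrows of the extended image: those that become of the form `F u` through isomorphisms of
their domain and codomain with objects in the image of `F`. -/
def IsArrow (F : 𝒞 ⥤ 𝒟) {x y : 𝒟} (f : x ⟶ y) : Prop :=
  ∃ (c d : 𝒞) (u : c ⟶ d) (i : x ≅ F.obj c) (j : y ≅ F.obj d), f = i.hom ≫ F.map u ≫ j.inv

instance : Category (ExtIm F hF) where
  Hom x y := {f : x.obj ⟶ y.obj // IsArrow F f}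
  id x := ⟨𝟙 x.obj, by
    obtain ⟨c, ⟨i⟩⟩ := x.mem
    exact ⟨c, c, 𝟙 c, i, i, by simp⟩⟩
  comp {x y z} f g := ⟨f.1 ≫ g.1, by
    obtain ⟨f, c, d, a, i, j, hf⟩ := f
    obtain ⟨g, c', d', a', i', j', hg⟩ := g
    obtain ⟨e, he⟩ := hF (j.symm ≪≫ i')
    have he' : F.map e.hom = j.inv ≫ i'.hom := congrArg Iso.hom he
    exact ⟨c, d', a ≫ e.hom ≫ a', i, j', by simp [hf, hg, he']⟩⟩

/-- The functor `F` with codomain restricted to its extended image. -/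
def corestrict (F : 𝒞 ⥤ 𝒟) (hF : CreatesIsos F) : 𝒞 ⥤ ExtIm F hF where
  obj c := ⟨F.obj c, c, ⟨Iso.refl _⟩⟩
  map {c d} f := ⟨F.map f, c, d, f, Iso.refl _, Iso.refl _, by simp⟩
  map_id c := Subtype.ext (F.map_id c)
  map_comp f g := Subtype.ext (F.map_comp f g)

end ExtIm

end Images

/-! ### Invariants -/

/-- A property of sets of elements of frames that is invariant under isomorphisms of frames.
Used both for invariant properties of families of subterminals of toposes (equivalently, of
families of elements of a locale) and for invariant properties of embeddings `B ↪ L` of a subset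
(with the induced order) into a frame. -/
structure Invariant : Type (u + 1) where
  Holds : ∀ (L : Type u) [Order.Frame L], Set L → Prop
  invariant : ∀ (L L' : Type u) [Order.Frame L] [Order.Frame L'] (e : L ≃o L') (s : Set L),
    Holds L s → Holds L' (e '' s)

section Compactness

variable {L : Type u} [Order.Frame L]

/-- The family `s` is refined by the family `t`. -/
def IsRefinedBy (s t : Set L) : Prop :=
  (∀ b ∈ t, ∃ a ∈ s, b ≤ a) ∧ sSup s = sSup t

/-- The family `s` has a refinement satisfying `Q` and made of elements of `B`. -/
def HasRefinementIn (Q : Invariant.{u}) (B s : Set L) : Prop :=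
  ∃ t : Set L, IsRefinedBy s t ∧ Q.Holds L t ∧ t ⊆ B

/-- The family `s` has a refinement satisfying `Q`. -/
def HasRefinement (Q : Invariant.{u}) (s : Set L) : Prop :=
  ∃ t : Set L, IsRefinedBy s t ∧ Q.Holds L t

/-- `l` is `Q`-compact: every covering family of `l` has a refinement satisfying `Q`. -/
def IsCompactElt (Q : Invariant.{u}) (l : L) : Prop :=
  ∀ s : Set L, sSup s = l → HasRefinement Q s

variable (L) in
/-- The set of `Q`-compact elements of a frame. -/
def compacts (Q : Invariant.{u}) : Set L := {l | IsCompactElt Q l}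

/-- `B` is a basis of the frame: every element is a join of elements of `B`. For the image of an
order embedding, this is density with respect to the canonical topology. -/
def IsBasis (B : Set L) : Prop := ∀ x : L, ∃ s ⊆ B, sSup s = x

end Compactness

namespace PosetCat

variable {K : PosetCat.{u}}

/-- The images in `L` of the domains of the arrows of a sieve. -/
def imageOfSieve {L : Type u} {c : K.Obj} (i : c → L) {a : c} (S : Sieve a) : Set L :=
  i '' {b | ∃ f : b ⟶ a, S f}

/-- The map `i : c → L` sends `J_c`-covering sieves to covering families. -/
def SendsCovers {L : Type u} [Order.Frame L] (c : K.Obj) (i : c → L) : Prop :=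
  ∀ (a : c) (S : Sieve a), S ∈ c.J a → sSup (imageOfSieve i S) = i a

/-- `J_c` is the topology induced along `i : c → L` by the canonical topology of `L` (the one
whose covering sieves are those containing a covering family). -/
def IsInducedByCanonical {L : Type u} [Order.Frame L] (c : K.Obj) (i : c → L) : Prop :=
  ∀ (a : c) (S : Sieve a), S ∈ c.J a ↔ sSup (imageOfSieve i S) = i a

/-- The sieve on `x` generated by the arrows `a ⟶ x` with `a ∈ F`. -/
def sieveOf {c : K.Obj} (F : Set c) (x : c) : Sieve x :=
  Sieve.generate fun a => {_f : a ⟶ x | a ∈ F}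

variable (K)

/-- The invariant property `P` of embeddings holds for all the canonical embeddings
`c ↪ Id_J(c)`. -/
def HoldsForCanonical (P : Invariant.{u}) : Prop :=
  ∀ c : K.Obj, P.Holds (jIdeals c.J) (principalIdeals c.J)

/-- `J_c` is `Q`-induced relative to `P`. -/
def IsInducedRel (Q P : Invariant.{u}) (c : K.Obj) : Prop :=
  ∀ (L : Type u) [Order.Frame L] (i : c ↪o L), IsBasis (Set.range i) →
    P.Holds L (Set.range i) → SendsCovers c i →
      ∀ F : Set c, (∃ x : c, (∀ a ∈ F, a ≤ x) ∧ sieveOf F x ∈ c.J x) ↔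
        HasRefinementIn Q (Set.range i) (i '' F)

/-- `J_c` is `Q`-induced. -/
def IsInduced (Q : Invariant.{u}) (c : K.Obj) : Prop :=
  ∃ P : Invariant.{u}, K.HoldsForCanonical P ∧ K.IsInducedRel Q P c

/-- For every structure `c` in `K`, a family of principal ideals on `c` having a refinement
satisfying `Q` has one made of principal ideals. -/
def PrincipalRefinements (Q : Invariant.{u}) : Prop :=
  ∀ (c : K.Obj) (F : Set (jIdeals c.J)), F ⊆ principalIdeals c.J →
    HasRefinement Q F → HasRefinementIn Q (principalIdeals c.J) F

variable {K}

/-- The image `B` of the order embedding `i : c ↪ L` is a basis of `L` made of `Q`-compact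
elements, which with the induced order is (identified through `i` with) the structure `c` of `K`,
and such that the embedding of `B` into `L` satisfies `P`, every covering in `L` of an element of
`B` has a refinement satisfying `Q` made of elements of `B`, and the `J_c`-covering sieves are sent
to covering families. -/
structure IsCompactBasis (Q P : Invariant.{u}) {L : Type u} [Order.Frame L] (c : K.Obj)
    (i : c ↪o L) : Prop where
  isBasis : IsBasis (Set.range i)
  isCompact : ∀ a, IsCompactElt Q (i a)
  prop : P.Holds L (Set.range i)
  refine : ∀ (a : c) (s : Set L), sSup s = i a → HasRefinementIn Q (Set.range i) s
  sendsCovers : SendsCovers c i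

variable (K)

/-- `Q` is `K`-compatible relative to `P`. -/
def IsCompatible (Q P : Invariant.{u}) : Prop :=
  K.HoldsForCanonical P ∧
    ∀ (L : Type u) [Order.Frame L] (c : K.Obj) (i : c ↪o L),
      IsCompactBasis Q P c i → IsInducedByCanonical c i

end PosetCat

end PosetDuality

/-!
For a subcanonical topology `J` on a poset, `b` lies in the principal ideal of `a` exactly when
`b ≤ a`. Hence the order of a structure of `K` can be read off from its set of ideals
(`idealLocale_injective`), and a morphism of sites can be read off from its action on principal
ideals, which generate the frame. So `A` is injective on objects and faithful, which makes it an
isomorphism onto its image.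

Since covers compose, an element belongs to the ideal generated by a set `F` as soon as the elements
below `F` cover it (`mem_genIdeal_iff`). It follows that `J` is induced by the canonical topology of
its frame of ideals (`isInducedByCanonical_canonical`), and that when `J` is `Q`-induced every family
of ideals with a principal join has a `Q`-refinement by principal ideals
(`hasRefinementIn_of_sSup_eq`). Together with the hypothesis on refinements by principal ideals this
shows that the principal ideals are precisely the `Q`-compact elements (`compacts_jIdeals`). As
`Q`-compactness is invariant, an isomorphism between frames of ideals restricts to an order
isomorphism of the underlying posets, which preserves covers in both directions and therefore comes
from `K`: the functor `A` creates isomorphisms (`createsIsos_A`). Being faithful, it is then an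
equivalence onto its extended image (`ExtIm.isEquivalence_corestrict`), and the counit of this
equivalence carries principal ideals to `Q`-compact elements.

For the intrinsic characterization, the conjunction of the properties witnessing that the topologies
are `Q`-induced is a property relative to which `Q` is compatible (`exists_isCompatible`). The
comparison lemma (`mem_of_le_sSup`, `idealIso`) identifies `L` with `Id_J(c)` whenever `c ↪ L` is a
basis along which `J_c` is induced by the canonical topology, and all the remaining statements are
transported along this isomorphism.
-/

namespace PosetDuality

/-! ### Ideals for a topology on a poset -/

section Ideals

variable {C : Type u} [PartialOrder C] (J : GrothendieckTopology C)

/-- Subcanonicity of a topology on a poset, spelled out: the principal lower sets are ideals. -/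
theorem isJIdeal_Iic (hJ : J.Subcanonical) (a : C) : IsJIdeal J (Set.Iic a) := by
  refine ⟨fun _ _ hba ha => le_trans hba ha, fun c R hR h => ?_⟩
  -- The inequalities `d ≤ a` form a matching family of the sheaf represented by `a`.
  have hs := GrothendieckTopology.Subcanonical.isSheaf_of_isRepresentable (J := J)
    (yoneda.obj a) R hR
  obtain ⟨t, -, -⟩ := hs (fun d f hf => homOfLE (h d f hf)) fun _ _ _ _ _ _ _ _ _ _ =>
    Subsingleton.elim (α := _ ⟶ a) _ _
  exact leOfHom t

theorem principalIdeal_le_iff {c : C} {I : jIdeals J} : principalIdeal J c ≤ I ↔ c ∈ I.1 := by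
  rw [principalIdeal, genIdeal_le_iff, Set.singleton_subset_iff]

theorem mem_principalIdeal_iff (hJ : J.Subcanonical) {a b : C} :
    b ∈ (principalIdeal J a).1 ↔ b ≤ a := by
  constructor
  · exact fun h => (principalIdeal_le_iff J (I := ⟨_, isJIdeal_Iic J hJ a⟩)).2 le_rfl h
  · exact fun h => (principalIdeal J a).2.1 h (subset_genIdeal J {a} rfl)

/-- The canonical embedding of a subcanonical site into its frame of ideals. -/
def principalEmbedding (hJ : J.Subcanonical) : C ↪o jIdeals J :=
  OrderEmbedding.ofMapLEIff (principalIdeal J) fun a b => by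
    rw [principalIdeal_le_iff, mem_principalIdeal_iff J hJ]

theorem sSup_image_principalIdeal (I : jIdeals J) : sSup (principalIdeal J '' I.1) = I := by
  apply le_antisymm
  · refine sSup_le ?_
    rintro _ ⟨a, ha, rfl⟩
    exact (principalIdeal_le_iff J).2 ha
  · exact fun a ha => (principalIdeal_le_iff J).1 (le_sSup ⟨a, ha, rfl⟩)

theorem isBasis_principalIdeals : IsBasis (principalIdeals J) := fun I =>
  ⟨_, Set.image_subset_range _ _, sSup_image_principalIdeal J I⟩

/-- The sieve of all arrows into `a` whose domain lies below some element of `A`. -/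
def sieveBelow (A : Set C) (a : C) : Sieve a where
  arrows d _ := ∃ x ∈ A, d ≤ x
  downward_closed := by
    rintro d e f ⟨x, hx, hdx⟩ g
    exact ⟨x, hx, (leOfHom g).trans hdx⟩

/-- A single covering step suffices to generate an ideal, because covers compose. -/
theorem mem_genIdeal_iff (A : Set C) (a : C) :
    a ∈ (genIdeal J A).1 ↔ sieveBelow A a ∈ J a := by
  constructor
  · have hI : IsJIdeal J {a | sieveBelow A a ∈ J a} := by
      refine ⟨fun x y hyx hx => ?_, fun c R hR h => ?_⟩
      · refine J.superset_covering ?_ (J.pullback_stable (homOfLE hyx) hx)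
        exact fun d f hf => hf
      · refine J.transitive hR _ fun d f hf => ?_
        exact J.superset_covering (fun e g hg => hg) (h d f hf)
    refine fun h => (genIdeal_le_iff J A ⟨_, hI⟩).2 (fun x hx => ?_) h
    have : sieveBelow A x = ⊤ := Sieve.ext fun d f =>
      ⟨fun _ => trivial, fun _ => ⟨x, hx, leOfHom f⟩⟩
    change sieveBelow A x ∈ J x
    rw [this]
    exact J.top_mem x
  · intro h
    refine (genIdeal J A).2.2 a _ h ?_
    rintro d f ⟨x, hx, hdx⟩
    exact (genIdeal J A).2.1 hdx (subset_genIdeal J A hx)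

theorem sSup_eq_genIdeal (s : Set (jIdeals J)) : sSup s = genIdeal J (⋃ I ∈ s, I.1) := by
  apply le_antisymm
  · exact sSup_le fun I hI => (Set.subset_biUnion_of_mem (u := fun I : jIdeals J => I.1) hI).trans
      (subset_genIdeal J _)
  · rw [genIdeal_le_iff]
    exact Set.iUnion₂_subset fun I hI => le_sSup hI

theorem sSup_image_principalIdeal_eq_genIdeal (A : Set C) :
    sSup (principalIdeal J '' A) = genIdeal J A := by
  apply le_antisymm
  · refine sSup_le ?_
    rintro _ ⟨a, ha, rfl⟩
    exact (principalIdeal_le_iff J).2 (subset_genIdeal J A ha)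
  · rw [genIdeal_le_iff]
    exact fun a ha => (principalIdeal_le_iff J).1 (le_sSup ⟨a, ha, rfl⟩)

theorem idealMap_principalIdeal {D : Type u} [PartialOrder D] {J : GrothendieckTopology C}
    {K : GrothendieckTopology D} {f : C →o D} (hf : IsSiteMorphism J K f) (c : C) :
    idealMap J K f (principalIdeal J c) = principalIdeal K (f c) :=
  eq_of_forall_ge_iff fun X => by
    rw [hf.idealMap_le_iff, principalIdeal_le_iff, principalIdeal_le_iff]
    rfl

/-- A cover-preserving order isomorphism is a morphism of sites. -/
theorem isSiteMorphism_of_orderIso {D : Type u} [PartialOrder D] {J : GrothendieckTopology C}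
    {K : GrothendieckTopology D} (e : C ≃o D)
    (h : ∀ (a : C) (S : Sieve a), S ∈ J a →
      sieveBelow (e '' {b | ∃ f : b ⟶ a, S f}) (e a) ∈ K (e a)) :
    IsSiteMorphism J K (e : C →o D) where
  flat := by
    have : (e : C →o D).monotone.functor.IsEquivalence := e.equivalence.isEquivalence_functor
    infer_instance
  cover := ⟨fun {a S} hS => by
    refine K.superset_covering ?_ (h a S hS)
    rintro d g ⟨_, ⟨b, ⟨f, hf⟩, rfl⟩, hd⟩
    exact ⟨b, f, homOfLE hd, hf, Subsingleton.elim _ _⟩⟩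

end Ideals

/-! ### Joins of elements of a basis -/

section Frames

variable {L L' : Type u} [Order.Frame L] [Order.Frame L']

theorem IsBasis.sSup_inter_Iic {B : Set L} (hB : IsBasis B) (x : L) :
    sSup (B ∩ Set.Iic x) = x := by
  apply le_antisymm (sSup_le fun b hb => hb.2)
  obtain ⟨s, hs, rfl⟩ := hB x
  exact sSup_le_sSup fun b hb => ⟨hs hb, le_sSup hb⟩

theorem IsBasis.frameHom_ext {B : Set L} (hB : IsBasis B) {f g : FrameHom L L'}
    (h : ∀ b ∈ B, f b = g b) : f = g := by
  ext x
  obtain ⟨s, hs, rfl⟩ := hB x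
  rw [map_sSup, map_sSup, Set.image_congr fun b hb => h b (hs hb)]

theorem IsBasis.image {B : Set L} (hB : IsBasis B) (e : L ≃o L') : IsBasis (e '' B) := fun x => by
  obtain ⟨s, hs, hx⟩ := hB (e.symm x)
  refine ⟨e '' s, Set.image_mono hs, ?_⟩
  rw [sSup_image, ← e.map_sSup, hx, e.apply_symm_apply]

/-! ### Invariance under isomorphisms of frames -/

theorem map_sSup_image (e : L ≃o L') (s : Set L) : sSup (e '' s) = e (sSup s) := by
  rw [sSup_image, e.map_sSup]

theorem IsRefinedBy.image {s t : Set L} (h : IsRefinedBy s t) (e : L ≃o L') :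
    IsRefinedBy (e '' s) (e '' t) := by
  refine ⟨?_, by rw [map_sSup_image, map_sSup_image, h.2]⟩
  rintro _ ⟨b, hb, rfl⟩
  obtain ⟨a, ha, hba⟩ := h.1 b hb
  exact ⟨e a, ⟨a, ha, rfl⟩, e.monotone hba⟩

theorem IsRefinedBy.trans {s t r : Set L} (h : IsRefinedBy s t) (h' : IsRefinedBy t r) :
    IsRefinedBy s r := by
  refine ⟨fun b hb => ?_, h.2.trans h'.2⟩
  obtain ⟨a, ha, hba⟩ := h'.1 b hb
  obtain ⟨x, hx, hax⟩ := h.1 a ha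
  exact ⟨x, hx, hba.trans hax⟩

variable {Q : Invariant.{u}}

theorem HasRefinementIn.image {B s : Set L} (h : HasRefinementIn Q B s) (e : L ≃o L') :
    HasRefinementIn Q (e '' B) (e '' s) := by
  obtain ⟨t, hst, ht, htB⟩ := h
  exact ⟨e '' t, hst.image e, Q.invariant L L' e t ht, Set.image_mono htB⟩

theorem HasRefinementIn.hasRefinement {B s : Set L} (h : HasRefinementIn Q B s) :
    HasRefinement Q s := by
  obtain ⟨t, hst, ht, -⟩ := h
  exact ⟨t, hst, ht⟩

theorem IsCompactElt.map {l : L} (h : IsCompactElt Q l) (e : L ≃o L') : IsCompactElt Q (e l) := by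
  intro s hs
  obtain ⟨t, hst, ht⟩ := h (e.symm '' s) (by rw [map_sSup_image, hs, e.symm_apply_apply])
  refine ⟨e '' t, ?_, Q.invariant L L' e t ht⟩
  simpa [Set.image_image] using hst.image e

theorem image_compacts (e : L ≃o L') : e '' compacts L Q = compacts L' Q := by
  ext x
  constructor
  · rintro ⟨l, hl, rfl⟩
    exact IsCompactElt.map hl e
  · exact fun hx => ⟨e.symm x, IsCompactElt.map hx e.symm, e.apply_symm_apply x⟩

end Frames

/-! ### Isomorphisms of locales -/

section Locales

variable {X Y Z : Locale.{u}}

theorem locale_hom_ext {f g : X ⟶ Y} (h : inverseImage f = inverseImage g) : f = g :=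
  Quiver.Hom.unop_inj (Frm.hom_ext h)

theorem inverseImage_comp (f : X ⟶ Y) (g : Y ⟶ Z) (z : Z) :
    inverseImage (f ≫ g) z = inverseImage f (inverseImage g z) := rfl

/-- The isomorphism of frames underlying an isomorphism of locales. -/
def orderIsoOfIso (l : X ≅ Y) : Y ≃o X where
  toFun := inverseImage l.hom
  invFun := inverseImage l.inv
  left_inv y := by rw [← inverseImage_comp, l.inv_hom_id]; rfl
  right_inv x := by rw [← inverseImage_comp, l.hom_inv_id]; rfl
  map_rel_iff' {a b} := by
    refine ⟨fun h => ?_, fun h => OrderHomClass.mono (inverseImage l.hom) h⟩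
    have h' := OrderHomClass.mono (inverseImage l.inv) h
    change inverseImage l.inv (inverseImage l.hom a) ≤
      inverseImage l.inv (inverseImage l.hom b) at h'
    rw [← inverseImage_comp, ← inverseImage_comp, l.inv_hom_id] at h'
    exact h'

/-- The isomorphism of locales given by an isomorphism of frames. -/
def isoOfOrderIso (e : Y ≃o X) : X ≅ Y := (Frm.Iso.mk e).op

end Locales

namespace PosetCat

variable {K : PosetCat.{u}}

/-! ### The canonical embedding into the frame of ideals -/

/-- The canonical embedding `c ↪ Id_J(c)` of a structure `c` of `K`. -/
def canonical (c : K.Obj) : c ↪o jIdeals c.J := principalEmbedding c.J (K.subcanonical _ c.mem)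

theorem sieveOf_eq_sieveBelow {c : K.Obj} {F : Set c} {x : c} (hF : ∀ a ∈ F, a ≤ x) :
    sieveOf F x = sieveBelow F x := by
  ext d f
  constructor
  · rintro ⟨a, g, h, ha, -⟩
    exact ⟨a, ha, leOfHom g⟩
  · rintro ⟨a, ha, hda⟩
    exact ⟨a, homOfLE hda, homOfLE (hF a ha), ha, Subsingleton.elim _ _⟩

theorem sieveBelow_domains {c : K.Obj} {a : c} (S : Sieve a) :
    sieveBelow {b | ∃ f : b ⟶ a, S f} a = S := by
  ext d f
  constructor
  · rintro ⟨b, ⟨g, hg⟩, hdb⟩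
    rw [Subsingleton.elim f (homOfLE hdb ≫ g)]
    exact S.downward_closed hg _
  · exact fun hf => ⟨d, ⟨f, hf⟩, le_rfl⟩

theorem sSup_imageOfSieve_sieveBelow {L : Type u} [Order.Frame L] {c : K.Obj} (i : c ↪o L)
    {F : Set c} {x : c} (hF : ∀ a ∈ F, a ≤ x) :
    sSup (imageOfSieve i (sieveBelow F x)) = sSup (i '' F) := by
  apply le_antisymm
  · refine sSup_le ?_
    rintro _ ⟨d, ⟨f, a, ha, hda⟩, rfl⟩
    exact (i.monotone hda).trans (le_sSup ⟨a, ha, rfl⟩)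
  · refine sSup_le_sSup (Set.image_mono fun a ha => ⟨homOfLE (hF a ha), a, ha, le_rfl⟩)

theorem isInducedByCanonical_canonical (c : K.Obj) : IsInducedByCanonical c (canonical c) := by
  intro a S
  have h : sSup (imageOfSieve (canonical c) S) = genIdeal c.J {b | ∃ f : b ⟶ a, S f} :=
    sSup_image_principalIdeal_eq_genIdeal _ _
  have h' : S ∈ c.J a ↔ principalIdeal c.J a ≤ genIdeal c.J {b | ∃ f : b ⟶ a, S f} := by
    rw [principalIdeal_le_iff, mem_genIdeal_iff, sieveBelow_domains]
  rw [h, h']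
  refine ⟨fun h => le_antisymm ?_ h, fun h => h.ge⟩
  rw [genIdeal_le_iff]
  rintro b ⟨f, -⟩
  exact (mem_principalIdeal_iff _ (K.subcanonical _ c.mem)).2 (leOfHom f)

theorem IsInducedByCanonical.sendsCovers {L : Type u} [Order.Frame L] {c : K.Obj} {i : c → L}
    (h : IsInducedByCanonical c i) : SendsCovers c i :=
  fun a S hS => (h a S).1 hS

variable {Q : Invariant.{u}}

theorem isInducedRel_canonical {c : K.Obj} (hI : K.IsInduced Q c) (F : Set c) :
    (∃ x : c, (∀ a ∈ F, a ≤ x) ∧ sieveOf F x ∈ c.J x) ↔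
      HasRefinementIn Q (principalIdeals c.J) (principalIdeal c.J '' F) := by
  obtain ⟨P, hP, hc⟩ := hI
  exact hc _ (canonical c) (isBasis_principalIdeals c.J) (hP c)
    (isInducedByCanonical_canonical c).sendsCovers F

/-- Any family of ideals with join a principal ideal has a `Q`-refinement by principal ideals: the
family of all principal ideals below some member comes from a covering sieve. -/
theorem hasRefinementIn_of_sSup_eq {c : K.Obj} (hI : K.IsInduced Q c) {a : c}
    {s : Set (jIdeals c.J)} (hs : sSup s = principalIdeal c.J a) :
    HasRefinementIn Q (principalIdeals c.J) s := by
  set F : Set c := ⋃ I ∈ s, I.1 with hF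
  have hFs : sSup s = genIdeal c.J F := sSup_eq_genIdeal _ _
  have hle : ∀ b ∈ F, b ≤ a := fun b hb => by
    have := subset_genIdeal c.J F hb
    rw [← hFs, hs] at this
    exact (mem_principalIdeal_iff _ (K.subcanonical _ c.mem)).1 this
  obtain ⟨t, ht, hQ, htB⟩ := (isInducedRel_canonical hI F).1 ⟨a, hle, by
    rw [sieveOf_eq_sieveBelow hle, ← mem_genIdeal_iff, ← hFs, hs, ← principalIdeal_le_iff]⟩
  refine ⟨t, IsRefinedBy.trans ⟨?_, ?_⟩ ht, hQ, htB⟩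
  · rintro _ ⟨b, hb, rfl⟩
    obtain ⟨I, hIs, hb⟩ := Set.mem_iUnion₂.1 hb
    exact ⟨I, hIs, (principalIdeal_le_iff _).2 hb⟩
  · rw [hFs, sSup_image_principalIdeal_eq_genIdeal]

theorem compacts_jIdeals (hK : K.PrincipalRefinements Q) {c : K.Obj} (hI : K.IsInduced Q c) :
    compacts (jIdeals c.J) Q = principalIdeals c.J := by
  ext l
  constructor
  · intro hl
    have h := hK c _ (Set.image_subset_range _ _) (hl _ (sSup_image_principalIdeal c.J l))
    obtain ⟨x, hx, hxJ⟩ := (isInducedRel_canonical hI l.1).2 h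
    refine ⟨x, ?_⟩
    rw [sieveOf_eq_sieveBelow hx, isInducedByCanonical_canonical,
      sSup_imageOfSieve_sieveBelow _ hx] at hxJ
    exact hxJ.symm.trans (sSup_image_principalIdeal c.J l)
  · rintro ⟨a, rfl⟩ s hs
    exact (hasRefinementIn_of_sSup_eq hI hs).hasRefinement

theorem isCompactBasis_canonical (hK : K.PrincipalRefinements Q) {c : K.Obj}
    (hI : K.IsInduced Q c) {P : Invariant.{u}} (hP : K.HoldsForCanonical P) :
    IsCompactBasis Q P c (canonical c) where
  isBasis := isBasis_principalIdeals c.J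
  isCompact a := (compacts_jIdeals hK hI).ge ⟨a, rfl⟩
  prop := hP c
  refine _ _ hs := hasRefinementIn_of_sSup_eq hI hs
  sendsCovers := (isInducedByCanonical_canonical c).sendsCovers

theorem IsCompactBasis.trans {P : Invariant.{u}} {L L' : Type u} [Order.Frame L] [Order.Frame L']
    {c : K.Obj} {i : c ↪o L} (h : IsCompactBasis Q P c i) (e : L ≃o L') :
    IsCompactBasis Q P c (i.trans e.toOrderEmbedding) := by
  have hr : Set.range (i.trans e.toOrderEmbedding) = e '' Set.range i := Set.range_comp e i
  refine ⟨hr ▸ h.isBasis.image e, fun a => (h.isCompact a).map e,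
    hr ▸ P.invariant L L' e _ h.prop, fun a s hs => ?_, fun a S hS => ?_⟩
  · have h' := (h.refine a (e.symm '' s) (by
      rw [map_sSup_image, hs]; exact e.symm_apply_apply (i a))).image e
    rw [hr]
    simpa [Set.image_image] using h'
  · have : imageOfSieve (i.trans e.toOrderEmbedding) S = e '' imageOfSieve i S :=
      Set.image_comp e i _
    rw [this, map_sSup_image, h.sendsCovers a S hS]
    rfl

/-! ### Recovering a locale from a basis -/

section Comparison

variable {L : Type u} [Order.Frame L] {c : K.Obj}

theorem isJIdeal_le {i : c ↪o L} (hi : SendsCovers c i) (x : L) : IsJIdeal c.J {a | i a ≤ x} := by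
  refine ⟨fun a b hba ha => (i.monotone hba).trans ha, fun a R hR h => ?_⟩
  change i a ≤ x
  rw [← hi a R hR]
  refine sSup_le ?_
  rintro _ ⟨b, ⟨f, hf⟩, rfl⟩
  exact h b f hf

/-- Comparison lemma: if `i : c ↪ L` is a basis and `J_c` is induced by the canonical topology
of `L`, then a `J_c`-ideal contains every element lying below its join in `L`. -/
theorem mem_of_le_sSup {i : c ↪o L} (hb : IsBasis (Set.range i)) (hi : IsInducedByCanonical c i)
    (I : jIdeals c.J) {a : c} (ha : i a ≤ sSup (i '' I.1)) : a ∈ I.1 := by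
  refine I.2.2 a (sieveBelow I.1 a) ?_ fun d f ⟨x, hx, hdx⟩ => I.2.1 hdx hx
  rw [hi]
  apply le_antisymm
  · refine sSup_le ?_
    rintro _ ⟨b, ⟨f, -⟩, rfl⟩
    exact i.monotone (leOfHom f)
  · -- By distributivity `i a` is the join of the `i a ⊓ i b` with `b ∈ I`, and each of these is
    -- the join of the basis elements below it.
    conv_lhs => rw [← inf_eq_left.2 ha]
    rw [inf_sSup_eq]
    refine iSup₂_le ?_
    rintro _ ⟨b, hbI, rfl⟩
    rw [← hb.sSup_inter_Iic (i a ⊓ i b)]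
    refine sSup_le_sSup ?_
    rintro _ ⟨⟨e, rfl⟩, he⟩
    exact ⟨e, ⟨homOfLE (i.le_iff_le.1 (le_inf_iff.1 he).1), b, hbI,
      i.le_iff_le.1 (le_inf_iff.1 he).2⟩, rfl⟩

/-- The isomorphism `Id_J(c) ≃ L` attached to a basis `i : c ↪ L` along which `J_c` is induced by
the canonical topology of `L`: an ideal goes to the join of its image. -/
def idealIso (i : c ↪o L) (hb : IsBasis (Set.range i)) (hi : IsInducedByCanonical c i) :
    jIdeals c.J ≃o L where
  toFun I := sSup (i '' I.1)
  invFun x := ⟨{a | i a ≤ x}, isJIdeal_le hi.sendsCovers x⟩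
  left_inv I := le_antisymm (fun _ ha => mem_of_le_sSup hb hi I ha)
    fun a ha => le_sSup ⟨a, ha, rfl⟩
  right_inv x := by
    have h : i '' {a | i a ≤ x} = Set.range i ∩ Set.Iic x := by
      rw [Set.inter_comm]
      exact Set.image_preimage_eq_inter_range (f := i) (t := Set.Iic x)
    exact (congrArg sSup h).trans (hb.sSup_inter_Iic x)
  map_rel_iff' {I I'} := ⟨fun h a ha => mem_of_le_sSup hb hi I'
      ((le_sSup (Set.mem_image_of_mem i ha)).trans h),
    fun h => sSup_le_sSup (Set.image_mono h)⟩

theorem idealIso_canonical (i : c ↪o L) (hb : IsBasis (Set.range i))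
    (hi : IsInducedByCanonical c i) (a : c) : idealIso i hb hi (canonical c a) = i a := by
  apply le_antisymm
  · refine sSup_le ?_
    rintro _ ⟨b, hb, rfl⟩
    exact i.monotone ((mem_principalIdeal_iff _ (K.subcanonical _ c.mem)).1 hb)
  · exact le_sSup ⟨a, subset_genIdeal c.J {a} rfl, rfl⟩

end Comparison

/-! ### Isomorphisms between frames of ideals -/

/-- An order isomorphism `c ≃ d` that extends to the frames of ideals preserves covers, because the
covers can be read off from the joins of principal ideals. -/
theorem isSiteMorphism_of_extends {c d : K.Obj} (E : jIdeals c.J ≃o jIdeals d.J) (e : c ≃o d)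
    (h : ∀ a, E (canonical c a) = canonical d (e a)) :
    IsSiteMorphism c.J d.J (e : c →o d) := by
  refine isSiteMorphism_of_orderIso e fun a S hS => ?_
  have hF : ∀ b ∈ e '' {b | ∃ f : b ⟶ a, S f}, b ≤ e a := by
    rintro _ ⟨b, ⟨f, -⟩, rfl⟩
    exact e.monotone (leOfHom f)
  rw [isInducedByCanonical_canonical, sSup_imageOfSieve_sieveBelow _ hF, ← h,
    ← (isInducedByCanonical_canonical c a S).1 hS, ← map_sSup_image, imageOfSieve,
    Set.image_image, Set.image_image]
  exact congrArg sSup (Set.image_congr fun b _ => (h b).symm)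

/-- An isomorphism of frames of ideals that preserves principal ideals, restricted to them. -/
theorem exists_orderIso_of_image_principalIdeals {c d : K.Obj} (E : jIdeals c.J ≃o jIdeals d.J)
    (h : E '' principalIdeals c.J = principalIdeals d.J) :
    ∃ e : c ≃o d, ∀ a, E (canonical c a) = canonical d (e a) := by
  have hf : ∀ a, ∃ b, canonical d b = E (canonical c a) := fun a => h.le ⟨_, ⟨a, rfl⟩, rfl⟩
  have hg : ∀ b, ∃ a, E (canonical c a) = canonical d b := fun b => by
    obtain ⟨_, ⟨a, rfl⟩, ha⟩ := h.ge ⟨b, rfl⟩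
    exact ⟨a, ha⟩
  choose f hf using hf
  choose g hg using hg
  refine ⟨⟨⟨f, g, fun a => ?_, fun b => ?_⟩, fun {a b} => ?_⟩, fun a => (hf a).symm⟩
  · exact (canonical c).injective (E.injective ((hg _).trans (hf a)))
  · exact (canonical d).injective ((hf _).trans (hg b))
  · change f a ≤ f b ↔ a ≤ b
    rw [← (canonical d).le_iff_le, hf, hf, E.le_iff_le, (canonical c).le_iff_le]

end PosetCat

/-! ### Functors onto their image and extended image -/

section Images

universe v₁ v₂ u₁ u₂

variable {𝒞 : Type u₁} [Category.{v₁} 𝒞] {𝒟 : Type u₂} [Category.{v₂} 𝒟]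

/-- A functor that is bijective on objects and fully faithful is an isomorphism of categories. -/
theorem exists_inverse_of_bijective_obj (F : 𝒞 ⥤ 𝒟) [F.Full] [F.Faithful]
    (h : Function.Bijective F.obj) : ∃ G : 𝒟 ⥤ 𝒞, F ⋙ G = 𝟭 _ ∧ G ⋙ F = 𝟭 _ := by
  obtain ⟨g, hgF, hFg⟩ := Function.bijective_iff_has_inverse.1 h
  let G : 𝒟 ⥤ 𝒞 :=
    { obj := g
      map := fun {x y} m => F.preimage (eqToHom (hFg x) ≫ m ≫ eqToHom (hFg y).symm)
      map_id := fun x => F.map_injective (by simp)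
      map_comp := fun m n => F.map_injective (by simp) }
  refine ⟨G, CategoryTheory.Functor.ext hgF fun c d m => F.map_injective ?_,
    CategoryTheory.Functor.ext hFg fun x y m => ?_⟩
  · simp [G, eqToHom_map]
  · simp [G]

theorem Im.exists_inverse_corestrict (F : 𝒞 ⥤ 𝒟) (hF : Function.Injective F.obj) [F.Faithful] :
    ∃ G : Im F hF ⥤ 𝒞, corestrict F hF ⋙ G = 𝟭 _ ∧ G ⋙ corestrict F hF = 𝟭 _ := by
  have : (corestrict F hF).Faithful := ⟨fun h => F.map_injective (congrArg Subtype.val h)⟩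
  have : (corestrict F hF).Full := ⟨fun {c d} ⟨g, c', d', f, hc, hd, hg⟩ => by
    obtain rfl := hF hc
    obtain rfl := hF hd
    -- Now the two `eqToHom` are identities.
    exact ⟨f, Subtype.ext (hg.trans ((Category.id_comp _).trans (Category.comp_id _))).symm⟩⟩
  refine exists_inverse_of_bijective_obj _ ⟨fun c d h => hF (congrArg Im.obj h), fun x => ?_⟩
  obtain ⟨x, c, rfl⟩ := x
  exact ⟨c, rfl⟩

/-- The extended image contains all the isomorphisms between its objects. -/
def ExtIm.isoMk {F : 𝒞 ⥤ 𝒟} {hF : CreatesIsos F} {x y : ExtIm F hF} (i : x.obj ≅ y.obj) :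
    x ≅ y where
  hom := ⟨i.hom, by
    obtain ⟨c, ⟨j⟩⟩ := y.mem
    exact ⟨c, c, 𝟙 c, i ≪≫ j, j, by simp⟩⟩
  inv := ⟨i.inv, by
    obtain ⟨c, ⟨j⟩⟩ := y.mem
    exact ⟨c, c, 𝟙 c, j, i ≪≫ j, by simp⟩⟩
  hom_inv_id := Subtype.ext i.hom_inv_id
  inv_hom_id := Subtype.ext i.inv_hom_id

theorem ExtIm.isEquivalence_corestrict (F : 𝒞 ⥤ 𝒟) (hF : CreatesIsos F) [F.Faithful] :
    (corestrict F hF).IsEquivalence where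
  faithful := ⟨fun h => F.map_injective (congrArg Subtype.val h)⟩
  full := ⟨fun {c d} ⟨g, c', d', f, i, j, hg⟩ => by
    obtain ⟨e, he⟩ := hF i
    obtain ⟨e', he'⟩ := hF j
    refine ⟨e.hom ≫ f ≫ e'.inv, Subtype.ext ?_⟩
    change F.map (e.hom ≫ f ≫ e'.inv) = g
    rw [hg, ← he, ← he', F.map_comp, F.map_comp]
    rfl⟩
  essSurj := ⟨fun ⟨_, c, ⟨i⟩⟩ => ⟨c, ⟨isoMk i.symm⟩⟩⟩

/-- Over a functor that creates isomorphisms, being an arrow of the extended image can be tested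
on any chosen isomorphisms with objects of the image. -/
theorem ExtIm.isArrow_iff {F : 𝒞 ⥤ 𝒟} (hF : CreatesIsos F) {x y : 𝒟} {c d : 𝒞} (i : x ≅ F.obj c)
    (j : y ≅ F.obj d) (f : x ⟶ y) :
    IsArrow F f ↔ ∃ u : c ⟶ d, f = i.hom ≫ F.map u ≫ j.inv := by
  refine ⟨?_, fun ⟨u, hu⟩ => ⟨c, d, u, i, j, hu⟩⟩
  rintro ⟨c', d', u, i', j', rfl⟩
  obtain ⟨e, he⟩ := hF (i.symm ≪≫ i')
  obtain ⟨e', he'⟩ := hF (j'.symm ≪≫ j)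
  refine ⟨e.hom ≫ u ≫ e'.hom, ?_⟩
  have h : F.map e.hom = i.inv ≫ i'.hom := congrArg Iso.hom he
  have h' : F.map e'.hom = j'.inv ≫ j.hom := congrArg Iso.hom he'
  simp [h, h']

end Images

namespace PosetCat

variable (K : PosetCat.{u})

/-! ### The functor to locales -/

/-- The order of a structure of `K` is determined by its set of ideals: `a ≤ b` means that every
ideal containing `b` contains `a`. -/
theorem le_iff_forall_ideal (c : K.Obj) (a b : c) :
    a ≤ b ↔ ∀ I ∈ (idealLocale c).opens, b ∈ I → a ∈ I :=
  ⟨fun h _ hI hb => hI.1 h hb,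
    fun h => h _ (isJIdeal_Iic c.J (K.subcanonical _ c.mem) b) le_rfl⟩

theorem idealLocale_injective : Function.Injective (idealLocale (K := K)) := by
  rintro ⟨@⟨C, o⟩, hC⟩ ⟨@⟨D, o'⟩, hD⟩ h
  obtain rfl : C = D := congrArg SetLocale.carrier h
  injection h with _ h _
  have h (I : Set C) : I ∈ (idealLocale (K := K) ⟨@PartOrd.of C o, hC⟩).opens ↔
      I ∈ (idealLocale (K := K) ⟨@PartOrd.of C o', hD⟩).opens := Set.ext_iff.1 h I
  obtain rfl : o = o' := PartialOrder.ext fun a b =>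
    (K.le_iff_forall_ideal ⟨@PartOrd.of C o, hC⟩ a b).trans <|
      (forall_congr' fun I => imp_congr_left (h I)).trans
        (K.le_iff_forall_ideal ⟨@PartOrd.of C o', hD⟩ a b).symm
  rfl

theorem setA_obj_injective : Function.Injective K.setA.obj :=
  fun _ _ h => unop_injective (K.idealLocale_injective h)

instance : K.setA.Faithful where
  map_injective {X Y} f g h := by
    refine Quiver.Hom.unop_inj (Subtype.ext (PartOrd.hom_ext (OrderHom.ext _ _ ?_)))
    funext y
    refine (canonical X.unop).injective ?_
    have h' := DFunLike.congr_fun (F := FrameHom (jIdeals Y.unop.J) (jIdeals X.unop.J)) h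
      (principalIdeal _ y)
    exact (idealMap_principalIdeal (isSiteMorphism_orderHom f.unop) y).symm.trans
      (h'.trans (idealMap_principalIdeal (isSiteMorphism_orderHom g.unop) y))

instance : SetLocale.toLocale.{u}.Faithful where
  map_injective {_ _} _ _ h := congrArg inverseImage h

instance : K.A.Faithful := inferInstanceAs (K.setA ⋙ SetLocale.toLocale).Faithful

variable {K}

theorem inverseImage_A_map {X Y : K.Objᵒᵖ} (f : X ⟶ Y) (y : Y.unop) :
    inverseImage (K.A.map f) (canonical Y.unop y) = canonical X.unop (orderHom f.unop y) :=
  idealMap_principalIdeal (isSiteMorphism_orderHom f.unop) y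

theorem A_hom_ext {X : Locale.{u}} {c : K.Obj} {f g : X ⟶ K.A.obj (op c)}
    (h : ∀ a, inverseImage f (canonical c a) = inverseImage g (canonical c a)) : f = g :=
  locale_hom_ext <| (isBasis_principalIdeals c.J).frameHom_ext <| by
    rintro _ ⟨a, rfl⟩
    exact h a

variable {Q : Invariant.{u}}

theorem createsIsos_A (hK : K.ContainsIsos) (hQ : K.PrincipalRefinements Q)
    (hI : ∀ c : K.Obj, K.IsInduced Q c) : CreatesIsos K.A := by
  intro c d l
  let E : jIdeals d.unop.J ≃o jIdeals c.unop.J := orderIsoOfIso l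
  have hE : E '' principalIdeals d.unop.J = principalIdeals c.unop.J := by
    rw [← compacts_jIdeals hQ (hI _), ← compacts_jIdeals hQ (hI _), image_compacts]
  obtain ⟨e, he⟩ := exists_orderIso_of_image_principalIdeals E hE
  have h₁ := isSiteMorphism_of_extends E e he
  have h₂ := isSiteMorphism_of_extends E.symm e.symm fun a => by
    rw [E.symm_apply_eq, he, e.apply_symm_apply]
  let u : d.unop ≅ c.unop :=
    { hom := ⟨PartOrd.ofHom (e : d.unop →o c.unop), hK _ _ e h₁ h₂⟩
      inv := ⟨PartOrd.ofHom (e.symm : c.unop →o d.unop), hK _ _ e.symm h₂ h₁⟩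
      hom_inv_id := Subtype.ext (PartOrd.hom_ext (OrderHom.ext _ _ (funext e.symm_apply_apply)))
      inv_hom_id := Subtype.ext (PartOrd.hom_ext (OrderHom.ext _ _ (funext e.apply_symm_apply))) }
  refine ⟨u.op, Iso.ext (A_hom_ext fun a => ?_)⟩
  exact (inverseImage_A_map u.op.hom a).trans (he a).symm

/-! ### The inverse functor on the extended image -/

theorem exists_inverse_extIm (hA : CreatesIsos K.A) (hQ : K.PrincipalRefinements Q)
    (hI : ∀ c : K.Obj, K.IsInduced Q c) :
    ∃ I : ExtIm K.A hA ⥤ K.Objᵒᵖ,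
      Nonempty (ExtIm.corestrict K.A hA ⋙ I ≅ 𝟭 _) ∧
      Nonempty (I ⋙ ExtIm.corestrict K.A hA ≅ 𝟭 _) ∧
      ∃ θ : ∀ X : ExtIm K.A hA, (I.obj X).unop ≃o compacts X.obj Q,
        ∀ (X Y : ExtIm K.A hA) (f : X ⟶ Y) (y : (I.obj Y).unop),
          (θ X (orderHom (I.map f).unop y) : X.obj) = inverseImage f.1 (θ Y y) := by
  have := ExtIm.isEquivalence_corestrict K.A hA
  let ε := (ExtIm.corestrict K.A hA).asEquivalence
  let I := ε.inverse
  -- The counit, as a natural isomorphism of locales `A (I X) ≅ X`.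
  let l (X : ExtIm K.A hA) : X.obj ≅ K.A.obj (I.obj X) :=
    { hom := (ε.counitIso.inv.app X).1
      inv := (ε.counitIso.hom.app X).1
      hom_inv_id := congrArg Subtype.val (ε.counitIso.inv_hom_id_app X)
      inv_hom_id := congrArg Subtype.val (ε.counitIso.hom_inv_id_app X) }
  have hl {X Y : ExtIm K.A hA} (f : X ⟶ Y) : (l X).hom ≫ K.A.map (I.map f) = f.1 ≫ (l Y).hom :=
    (congrArg Subtype.val (ε.counitIso.inv.naturality f)).symm
  let i (X : ExtIm K.A hA) : (I.obj X).unop ↪o X.obj :=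
    (canonical (I.obj X).unop).trans (orderIsoOfIso (l X)).toOrderEmbedding
  have hi (X : ExtIm K.A hA) : Set.range (i X) = compacts X.obj Q := by
    have h : compacts (K.A.obj (I.obj X)) Q = Set.range (canonical (I.obj X).unop) :=
      compacts_jIdeals hQ (hI _)
    rw [← image_compacts (orderIsoOfIso (l X)), h]
    exact Set.range_comp (orderIsoOfIso (l X)) (canonical (I.obj X).unop)
  refine ⟨I, ⟨ε.unitIso.symm⟩, ⟨ε.counitIso⟩,
    fun X => (i X).orderIso.trans (OrderIso.setCongr _ _ (hi X)), fun X Y f y => ?_⟩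
  change inverseImage (l X).hom (canonical _ (orderHom (I.map f).unop y)) =
    inverseImage f.1 (inverseImage (l Y).hom (canonical _ y))
  rw [← inverseImage_A_map]
  exact congrArg (fun g => inverseImage g (canonical _ y)) (hl f)

/-! ### Bases made of compact elements -/

theorem isInducedByCanonical_of_isInducedRel {P : Invariant.{u}} {c : K.Obj}
    (hP : K.IsInducedRel Q P c) {L : Type u} [Order.Frame L] {i : c ↪o L}
    (hb : IsBasis (Set.range i)) (hPi : P.Holds L (Set.range i)) (hi : SendsCovers c i)
    (hr : ∀ (a : c) (s : Set L), sSup s = i a → HasRefinementIn Q (Set.range i) s) :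
    IsInducedByCanonical c i := by
  refine fun a S => ⟨hi a S, fun h => ?_⟩
  obtain ⟨x, hx, hxJ⟩ := (hP L i hb hPi hi {b | ∃ f : b ⟶ a, S f}).2 (hr a _ h)
  rw [sieveOf_eq_sieveBelow hx] at hxJ
  have hxa := hi x _ hxJ
  rw [sSup_imageOfSieve_sieveBelow i hx] at hxa
  obtain rfl := i.injective (hxa.symm.trans h)
  rwa [sieveBelow_domains] at hxJ

theorem exists_isCompatible (hI : ∀ c : K.Obj, K.IsInduced Q c) :
    ∃ P : Invariant.{u}, K.IsCompatible Q P := by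
  choose P hP hPc using hI
  -- The conjunction of the properties witnessing that the topologies are `Q`-induced.
  refine ⟨⟨fun L _ s => ∀ c, (P c).Holds L s, fun L L' _ _ e s h c =>
    (P c).invariant L L' e s (h c)⟩, fun d c => hP c d, fun L _ c i h => ?_⟩
  exact isInducedByCanonical_of_isInducedRel (hPc c) h.isBasis (h.prop c) h.sendsCovers h.refine

/-- The isomorphism of locales `X ≅ Id_J(c)` attached to a basis of `X` identified with `c`. -/
def isoOfBasis {X : Locale.{u}} {c : K.Obj} (i : c ↪o X) (hb : IsBasis (Set.range i))
    (hi : IsInducedByCanonical c i) : X ≅ K.A.obj (op c) :=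
  isoOfOrderIso (Y := K.A.obj (op c)) (idealIso i hb hi)

theorem inverseImage_isoOfBasis_hom {X : Locale.{u}} {c : K.Obj} (i : c ↪o X)
    (hb : IsBasis (Set.range i)) (hi : IsInducedByCanonical c i) (a : c) :
    inverseImage (isoOfBasis i hb hi).hom (canonical c a) = i a :=
  idealIso_canonical i hb hi a

theorem iso_A_iff_exists_isCompactBasis (hQ : K.PrincipalRefinements Q)
    (hI : ∀ c : K.Obj, K.IsInduced Q c) {P : Invariant.{u}} (hP : K.IsCompatible Q P)
    (X : Locale.{u}) : (∃ c, Nonempty (X ≅ K.A.obj c)) ↔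
      ∃ (c : K.Obj) (i : c ↪o X), IsCompactBasis Q P c i := by
  constructor
  · rintro ⟨c, ⟨l⟩⟩
    exact ⟨c.unop, _, (isCompactBasis_canonical hQ (hI c.unop) hP.1).trans (orderIsoOfIso l)⟩
  · rintro ⟨c, i, h⟩
    exact ⟨op c, ⟨isoOfBasis i h.isBasis (hP.2 X c i h)⟩⟩

theorem IsCompactBasis.range_eq (hQ : K.PrincipalRefinements Q) {P : Invariant.{u}}
    (hP : K.IsCompatible Q P) {L : Type u} [Order.Frame L] {c : K.Obj} (hI : K.IsInduced Q c)
    {i : c ↪o L} (h : IsCompactBasis Q P c i) : Set.range i = compacts L Q := by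
  rw [← image_compacts (idealIso i h.isBasis (hP.2 L c i h)), compacts_jIdeals hQ hI]
  exact (congrArg Set.range
    (funext fun a => (idealIso_canonical i h.isBasis (hP.2 L c i h) a).symm)).trans
    (Set.range_comp _ _)

/-- An arrow of the extended image is one that is given by an arrow of `K` on chosen bases. -/
theorem isArrow_A_iff (hA : CreatesIsos K.A) {X Y : Locale.{u}} {c d : K.Obj} {i : c ↪o X}
    {j : d ↪o Y} (hi : IsBasis (Set.range i)) (hj : IsBasis (Set.range j))
    (hi' : IsInducedByCanonical c i) (hj' : IsInducedByCanonical d j) (f : X ⟶ Y) :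
    ExtIm.IsArrow K.A f ↔ ∃ u : d ⟶ c, ∀ a : d, i (orderHom u a) = inverseImage f (j a) := by
  rw [ExtIm.isArrow_iff hA (isoOfBasis i hi hi') (isoOfBasis j hj hj')]
  have key (u : d ⟶ c) : f = (isoOfBasis i hi hi').hom ≫ K.A.map u.op ≫ (isoOfBasis j hj hj').inv ↔
      ∀ a : d, i (orderHom u a) = inverseImage f (j a) := by
    rw [← Category.assoc, Iso.eq_comp_inv]
    have h₁ (a : d) : inverseImage (f ≫ (isoOfBasis j hj hj').hom) (canonical d a) =
        inverseImage f (j a) :=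
      congrArg (inverseImage f) (inverseImage_isoOfBasis_hom _ _ _ _)
    have h₂ (a : d) : inverseImage ((isoOfBasis i hi hi').hom ≫ K.A.map u.op) (canonical d a) =
        i (orderHom u a) :=
      (congrArg (inverseImage (isoOfBasis i hi hi').hom) (inverseImage_A_map u.op a)).trans
        (inverseImage_isoOfBasis_hom _ _ _ _)
    refine ⟨fun h a => ?_, fun h => A_hom_ext fun a => ?_⟩
    · rw [← h₁, ← h₂, h]
    · rw [h₁, h₂, h]
  exact ⟨fun ⟨u, hu⟩ => ⟨u.unop, (key u.unop).1 hu⟩, fun ⟨u, hu⟩ => ⟨u.op, (key u).2 hu⟩⟩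

end PosetCat

end PosetDuality

open PosetDuality PosetDuality.PosetCat in
theorem theorem3p13 (K : PosetCat.{u}) :
    -- `A` is an isomorphism of categories between `K^op` and its image
    (∃ (hA : Function.Injective K.setA.obj) (G : Im K.setA hA ⥤ K.Objᵒᵖ),
      Im.corestrict K.setA hA ⋙ G = 𝟭 _ ∧ G ⋙ Im.corestrict K.setA hA = 𝟭 _) ∧
    ∀ Q : Invariant.{u}, K.ContainsIsos → K.PrincipalRefinements Q →
      (∀ c : K.Obj, K.IsInduced Q c) →
      -- the inverse on the extended image
      (∃ (hA : CreatesIsos K.A) (I : ExtIm K.A hA ⥤ K.Objᵒᵖ),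
        Nonempty (ExtIm.corestrict K.A hA ⋙ I ≅ 𝟭 _) ∧
        Nonempty (I ⋙ ExtIm.corestrict K.A hA ≅ 𝟭 _) ∧
        ∃ θ : ∀ X : ExtIm K.A hA, (I.obj X).unop ≃o compacts X.obj Q,
          ∀ (X Y : ExtIm K.A hA) (f : X ⟶ Y) (y : (I.obj Y).unop),
            (θ X (orderHom (I.map f).unop y) : X.obj) = inverseImage f.1 (θ Y y)) ∧
      -- the intrinsic characterization of the extended image
      (∃ P : Invariant.{u}, K.IsCompatible Q P) ∧
      ∀ P : Invariant.{u}, K.IsCompatible Q P →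
        (∀ X : Locale.{u}, (∃ c, Nonempty (X ≅ K.A.obj c)) ↔
          ∃ (c : K.Obj) (i : c ↪o X), IsCompactBasis Q P c i) ∧
        ∀ (X Y : Locale.{u}) (c d : K.Obj) (i : c ↪o X) (j : d ↪o Y),
          IsCompactBasis Q P c i → IsCompactBasis Q P d j →
          Set.range i = compacts X Q ∧ Set.range j = compacts Y Q ∧
          ∀ f : X ⟶ Y, ExtIm.IsArrow K.A f ↔
            (∀ y ∈ compacts Y Q, inverseImage f y ∈ compacts X Q) ∧
            ∃ u : d ⟶ c, ∀ a : d, i (orderHom u a) = inverseImage f (j a) := by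
  refine ⟨⟨K.setA_obj_injective, Im.exists_inverse_corestrict _ _⟩, fun Q hK hQ hI => ?_⟩
  have hA := createsIsos_A hK hQ hI
  refine ⟨⟨hA, exists_inverse_extIm hA hQ hI⟩, exists_isCompatible hI, fun P hP =>
    ⟨iso_A_iff_exists_isCompactBasis hQ hI hP, fun X Y c d i j hi hj => ?_⟩⟩
  have hci := hi.range_eq hQ hP (hI c)
  have hdj := hj.range_eq hQ hP (hI d)
  refine ⟨hci, hdj, fun f => ?_⟩
  rw [isArrow_A_iff hA hi.isBasis hj.isBasis (hP.2 X c i hi) (hP.2 Y d j hj)]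
  refine ⟨fun ⟨u, hu⟩ => ⟨?_, u, hu⟩, fun h => h.2⟩
  rw [← hci, ← hdj]
  rintro _ ⟨a, rfl⟩
  exact ⟨_, hu a⟩
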